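/- Let $K$ be a field, $R=K[x_0,\dots,x_N]$ with the standard grading, and $M=\langle x_0,\dots,x_N\rangle$. Let $H_1,\dots,H_s$, with $s\ge N+1$, be distinct hyperplanes in $\mathbb P^N$, given by nonzero linear forms $\ell_1,\dots,\ell_s\in R$, which meet properly: the intersection of any $j$ of them is either empty or of codimension $j$. Let $1\le c\le N$, let $V_c=\bigcup_{1\le j_1<\dots<j_c\le s}H_{j_1}\cap\dots\cap H_{j_c}$ be the star configuration of codimension $c$, and let $I=I(V_c)\subset R$ be its defining ideal (the points of $\mathbb P^N$ are those of $\operatorname{Proj} R$), so that $I=\bigcap_{1\le j_1<\dots<j_c\le s}\langle \ell_{j_1},\dots,\ell_{j_c}\rangle$. Write $I^{(m)}=\bigcap_{P\in\operatorname{Ass}(R/I)}(I^mR_P\cap R)$ for the $m$-th symbolic power of $I$, and $\alpha(J)$ for the least degree of a nonzero element of a nonzero homogeneous ideal $J\subseteq R$. Then for every integer $m\ge 1$: 1. $I^{(mc)}\subseteq M^{m(c-1)}I^m$. In particular, if $\operatorname{ht}(I)=N$, then $I^{(mN)}\subseteq M^{m(N-1)}I^m$. 2. $I^{(mc-c+1)}\subseteq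 I^m$ and $I^{(mN-N+1)}\subseteq I^m$. 3. $I^{(mc-c+1)}\subseteq M^{(m-1)(c-1)}I^m$. In particular, if $\operatorname{ht}(I)=N$, then $I^{(mN-N+1)}\subseteq M^{(m-1)(N-1)}I^m$. 4. For all integers $t\ge 1$, $\dfrac{\alpha(I^{(t)})}{t}\ge\dfrac{\alpha(I^{(m)})+c-1}{m+c-1}$. 5. For all integers $t\ge 1$, $\dfrac{\alpha(I^{(t)})}{t}\ge\dfrac{\alpha(I^{(m)})+N-1}{m+N-1}$. 6. For all integers $t\ge 1$, $\dfrac{\alpha(I^{(t)})}{t}\ge\dfrac{\alpha(I)+N-1}{N}$. -/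

import Mathlib

noncomputable section

attribute [local instance] MvPolynomial.gradedAlgebra

namespace StarConfig

/-- The standard grading of `K[x_0, …, x_N]`. -/
abbrev grading (K : Type*) [Field K] (N : ℕ) :
    ℕ → Submodule K (MvPolynomial (Fin (N + 1)) K) :=
  MvPolynomial.homogeneousSubmodule (Fin (N + 1)) K

/-- Projective space `ℙ^N` over `K`, as the space of points of `Proj K[x_0, …, x_N]`
(this gives the right notion over every field, also over a finite one). -/
abbrev PSpace (K : Type*) [Field K] (N : ℕ) : Type _ :=
  ProjectiveSpectrum (grading K N)

/-- The closed subset `V(ℓ)` of `ℙ^N`. -/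
def hyperplane {K : Type*} [Field K] {N : ℕ} (ℓ : MvPolynomial (Fin (N + 1)) K) :
    Set (PSpace K N) :=
  ProjectiveSpectrum.zeroLocus (grading K N) {ℓ}

/-- The (homogeneous, radical) defining ideal `I(Z)` of a subset `Z` of `ℙ^N`. -/
def definingIdeal {K : Type*} [Field K] {N : ℕ} (Z : Set (PSpace K N)) :
    Ideal (MvPolynomial (Fin (N + 1)) K) :=
  (ProjectiveSpectrum.vanishingIdeal Z).toIdeal

/-- The codimension of `Z` in `ℙ^N`: the height of its defining ideal. -/
def codim {K : Type*} [Field K] {N : ℕ} (Z : Set (PSpace K N)) : ℕ∞ :=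
  (definingIdeal Z).height

/-- `ℓ_1, …, ℓ_s` are defining linear forms of distinct hyperplanes of `ℙ^N` that meet properly:
the intersection of any `j` of the hyperplanes is either empty or of codimension `j`. -/
structure IsProperArrangement {K : Type*} [Field K] {N s : ℕ}
    (ℓ : Fin s → MvPolynomial (Fin (N + 1)) K) : Prop where
  linear : ∀ i, (ℓ i).IsHomogeneous 1
  ne_zero : ∀ i, ℓ i ≠ 0
  distinct : Function.Injective fun i => hyperplane (ℓ i)
  proper : ∀ J : Finset (Fin s),
    (⋂ i ∈ J, hyperplane (ℓ i)) = ∅ ∨ codim (⋂ i ∈ J, hyperplane (ℓ i)) = J.card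

/-- The star configuration `V_c`: the union of all intersections of `c` of the hyperplanes. -/
def starConfiguration {K : Type*} [Field K] {N s : ℕ}
    (ℓ : Fin s → MvPolynomial (Fin (N + 1)) K) (c : ℕ) : Set (PSpace K N) :=
  ⋃ J ∈ {J : Finset (Fin s) | J.card = c}, ⋂ i ∈ J, hyperplane (ℓ i)

/-- The `m`-th symbolic power `I^{(m)}`: the intersection over all associated primes `P` of `R ⧸ I`
of the contractions `I^m R_P ∩ R`. -/
def symbolicPower {R : Type*} [CommRing R] (I : Ideal R) (m : ℕ) : Ideal R :=
  ⨅ P : associatedPrimes R (R ⧸ I),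
    haveI : P.1.IsPrime := P.2.isPrime
    ((I ^ m).map (algebraMap R (Localization.AtPrime P.1))).comap
      (algebraMap R (Localization.AtPrime P.1))

/-- The irrelevant maximal ideal `⟨x_0, …, x_N⟩`. -/
def irrelevantIdeal (K : Type*) [Field K] (N : ℕ) : Ideal (MvPolynomial (Fin (N + 1)) K) :=
  Ideal.span (Set.range MvPolynomial.X)

/-- `α(J)`: the least degree of a nonzero element of `J` (for `J ≠ 0`). -/
def alpha {K : Type*} [Field K] {N : ℕ} (J : Ideal (MvPolynomial (Fin (N + 1)) K)) : ℕ :=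
  sInf {d : ℕ | ∃ f ∈ J, f ≠ 0 ∧ f.totalDegree = d}

end StarConfig

end

noncomputable section

attribute [local instance] MvPolynomial.gradedAlgebra

namespace StarConfig
open MvPolynomial

/-! For a `c`-element set `J`, let `P_J` be the ideal generated by the `ℓ i`, `i ∈ J`. Proper
meeting makes any `N + 1` of the forms independent, so each `P_J` behaves like an ideal of
variables: it is prime with primary powers, and `I^(m) = ⋂ P_J^m`
(`mem_symbolicPower_iff_of_forall`). The central fact is that `I^(m)` is generated by the products
`∏ ℓ i ^ a i` it contains, those with `∑ i ∈ J, a i ≥ m` for every `J`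
(`mem_productIdeal_of_forall_mem`). Everything then becomes a question about exponent vectors.

Containments: if every `c` exponents sum to at least `D > c(m-1)`, fewer than `c` of them are below
`m`. The other indices include a set `A` of size `s-c+1`, which meets every `J`, so `∏_A ℓ i ∈ I`.
Splitting off its `m`-th power leaves a product of degree at least `D-m`, whence `I^(D) ≤ M^(D-m)
I^m`. The choices `D = mn` and `D = mn-n+1` with `n = c` or `n = N` give all containments.

Degrees: `s/c` separates the two sides. An exchange argument gives `α(I^(t))/t ≥ s/c`, and nearly
constant exponents give `(α(I^(m))+c-1)/(m+c-1) ≤ s/c`. Since `s/c ≥ 1`, adding `N-c` to numerator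
and denominator keeps the second bound. -/

theorem prod_pow_mem_pow_sum {R ι : Type*} [CommRing R] {I : Ideal R} {s : Finset ι}
    {x : ι → R} {a : ι → ℕ} (h : ∀ i ∈ s, x i ∈ I) :
    ∏ i ∈ s, x i ^ a i ∈ I ^ ∑ i ∈ s, a i := by
  rw [← Finset.prod_pow_eq_pow_sum]
  exact Ideal.prod_mem_prod fun i hi => Ideal.pow_mem_pow (h i hi) _

/-! ### Independent linear forms as variables -/

section LinearForms

variable {σ K : Type*} [Field K]

/-- The polynomial ring is the symmetric algebra on its space of linear forms. Extending the given
forms to a basis of that space and using it as a new set of variables gives the isomorphism. -/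
theorem exists_algEquiv_X {S : Set (MvPolynomial σ K)} (hS : ∀ f ∈ S, f.IsHomogeneous 1)
    (hli : LinearIndepOn K id S) :
    ∃ (τ : Set (σ →₀ K)) (φ : MvPolynomial σ K ≃ₐ[K] MvPolynomial τ K) (v : S → τ),
      Function.Injective v ∧ ∀ f : S, φ f = X (v f) := by
  let L : (σ →₀ K) →ₗ[K] MvPolynomial σ K := Finsupp.linearCombination K X
  let ψ := SymmetricAlgebra.equivMvPolynomial (Finsupp.basisSingleOne (R := K) (ι := σ))
  have hψ : ∀ m, ψ (SymmetricAlgebra.ι K _ m) = L m := by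
    intro m
    have : ψ.toLinearMap ∘ₗ SymmetricAlgebra.ι K _ = L := by
      refine (Finsupp.basisSingleOne (R := K) (ι := σ)).ext fun i => ?_
      simp only [LinearMap.comp_apply, AlgEquiv.toLinearMap_apply, ψ,
        SymmetricAlgebra.equivMvPolynomial_ι_apply]
      simp [L]
    exact LinearMap.congr_fun this m
  have hex : ∀ f : S, ∃ m, L m = f := by
    intro f
    have h1 : (f : MvPolynomial σ K) ∈ homogeneousSubmodule σ K 1 :=
      (mem_homogeneousSubmodule 1 _).2 (hS f f.2)
    rw [homogeneousSubmodule_one_eq_span_X, ← Finsupp.range_linearCombination] at h1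
    exact h1
  choose g hg using hex
  have hgli : LinearIndependent K g := by
    refine LinearIndependent.of_comp L ?_
    have : L ∘ g = fun f : S => (id (f : MvPolynomial σ K)) := funext hg
    rw [this]
    exact hli
  have hr := hgli.linearIndepOn_id
  let b := Module.Basis.extend hr
  refine ⟨_, ψ.symm.trans (SymmetricAlgebra.equivMvPolynomial b),
    fun f => ⟨g f, Module.Basis.subset_extend hr ⟨f, rfl⟩⟩, ?_, ?_⟩
  · intro f f' h
    exact hgli.injective (congrArg Subtype.val h)
  · intro f
    have h1 : ψ.symm f = SymmetricAlgebra.ι K _ (g f) := by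
      rw [AlgEquiv.symm_apply_eq, hψ, hg]
    rw [AlgEquiv.trans_apply, h1]
    have h2 : g f = b ⟨g f, Module.Basis.subset_extend hr ⟨f, rfl⟩⟩ := by
      simp [b]
    conv_lhs => rw [h2]
    exact SymmetricAlgebra.equivMvPolynomial_ι_apply b _

/-- Giving each variable in `T` weight `e` lets one such variable satisfy the bound alone, so a
single weighted order describes the sum of the two monomial ideals. -/
theorem mem_span_X_pow_sup_iff {A T : Set σ} {e : ℕ} {f : MvPolynomial σ K}
    (w : σ → ℕ) (hwA : ∀ i ∈ A, w i = 1) (hwT : ∀ i ∈ T, w i = e)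
    (hw : ∀ i, i ∉ A → i ∉ T → w i = 0) :
    f ∈ Ideal.span (X '' A : Set (MvPolynomial σ K)) ^ e ⊔ Ideal.span (X '' T) ↔
      ∀ d ∈ f.support, e ≤ Finsupp.weight w d := by
  constructor
  · intro hf
    -- The polynomials of weighted order at least `n`. Multiplicativity of the order makes `O 1 ^ e`
    -- lie in `O e`.
    let O : ℕ → Ideal (MvPolynomial σ K) := fun n =>
      { carrier := {f | (n : ℕ∞) ≤ (f : MvPowerSeries σ K).weightedOrder w}
        zero_mem' := by simp
        add_mem' := fun {a b} ha hb => by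
          simp only [Set.mem_ofPred_eq, coe_add] at *
          exact le_trans (le_min ha hb) (MvPowerSeries.min_weightedOrder_le_add w)
        smul_mem' := fun c x hx => by
          simp only [Set.mem_ofPred_eq, smul_eq_mul, coe_mul] at *
          rw [MvPowerSeries.weightedOrder_mul]
          exact hx.trans le_add_self }
    have hO : ∀ n f, f ∈ O n ↔ (n : ℕ∞) ≤ (f : MvPowerSeries σ K).weightedOrder w :=
      fun _ _ => Iff.rfl
    have hX : ∀ i, (X i : MvPolynomial σ K) ∈ O (w i) := by
      intro i
      rw [hO]
      rw [show ((X i : MvPolynomial σ K) : MvPowerSeries σ K)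
        = MvPowerSeries.monomial (Finsupp.single i 1) 1 by
          rw [MvPolynomial.coe_X]; rfl,
        MvPowerSeries.weightedOrder_monomial_of_ne_zero w one_ne_zero]
      simp [Finsupp.weight_apply]
    have hle : Ideal.span (X '' A : Set (MvPolynomial σ K)) ^ e ⊔ Ideal.span (X '' T) ≤ O e := by
      refine sup_le ?_ ?_
      · have h1 : Ideal.span (X '' A : Set (MvPolynomial σ K)) ≤ O 1 := by
          rw [Ideal.span_le]
          rintro _ ⟨i, hi, rfl⟩
          have := hX i
          rwa [hwA i hi] at this
        refine (Ideal.pow_right_mono h1 e).trans ?_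
        clear hf hwT
        induction e with
        | zero => intro x _; rw [hO]; simp
        | succ e ih =>
          rw [pow_succ, Ideal.mul_le]
          intro a ha b hb
          have ha := ih ha
          rw [hO] at *
          rw [coe_mul, MvPowerSeries.weightedOrder_mul]
          push_cast
          exact add_le_add ha hb
      · rw [Ideal.span_le]
        rintro _ ⟨i, hi, rfl⟩
        have := hX i
        rwa [hwT i hi] at this
    intro d hd
    have := (hle hf : (e : ℕ∞) ≤ _).trans
      (MvPowerSeries.weightedOrder_le w (d := d) (f := (f : MvPowerSeries σ K))
        (by simpa using hd))
    exact_mod_cast this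
  · intro hf
    rw [f.as_sum]
    refine Ideal.sum_mem _ fun d hd => ?_
    specialize hf d hd
    rw [← mul_one (coeff d f), ← smul_eq_mul, ← smul_monomial]
    rw [smul_eq_C_mul]
    refine Ideal.mul_mem_left _ _ ?_
    by_cases hT : ∃ i ∈ T, d i ≠ 0
    · refine Ideal.mem_sup_right ?_
      rw [mem_ideal_span_X_image]
      intro m hm
      have : m = d := by
        classical
        simpa [mem_support_iff, coeff_monomial, eq_comm] using hm
      rwa [this]
    · push Not at hT
      refine Ideal.mem_sup_left ?_
      classical
      have hsum : Finsupp.weight w d = ∑ i ∈ d.support with i ∈ A, d i := by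
        rw [Finsupp.weight_apply, Finsupp.sum, Finset.sum_filter]
        refine Finset.sum_congr rfl fun i hi => ?_
        split_ifs with h
        · simp [hwA i h]
        · by_cases h' : i ∈ T
          · simp [hT i h']
          · simp [hw i h h']
      rw [monomial_eq, Finsupp.prod, ← Finset.prod_filter_mul_prod_filter_not _ (· ∈ A), C_1,
        one_mul]
      refine Ideal.mul_mem_right _ _ (Ideal.pow_le_pow_right (hf.trans_eq hsum) ?_)
      exact prod_pow_mem_pow_sum fun i hi =>
        Ideal.subset_span ⟨i, (Finset.mem_filter.1 hi).2, rfl⟩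

/-- Weighted order is additive on products, and an element outside the ideal of all the variables in
`A` and `T` has order zero. -/
theorem mem_span_X_of_mul_mem {A T : Set σ} (hAT : Disjoint A T) {e : ℕ}
    {u h : MvPolynomial σ K}
    (hu : u ∉ Ideal.span (X '' A : Set (MvPolynomial σ K)) ⊔ Ideal.span (X '' T))
    (huh : u * h ∈ Ideal.span (X '' A : Set (MvPolynomial σ K)) ^ e ⊔ Ideal.span (X '' T)) :
    h ∈ Ideal.span (X '' A : Set (MvPolynomial σ K)) ^ e ⊔ Ideal.span (X '' T) := by
  classical
  rcases Nat.eq_zero_or_pos e with rfl | he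
  · simp
  let w : σ → ℕ := fun i => if i ∈ A then 1 else if i ∈ T then e else 0
  have hwA : ∀ i ∈ A, w i = 1 := fun i hi => by simp [w, hi]
  have hwT : ∀ i ∈ T, w i = e := fun i hi => by
    have : i ∉ A := fun h => (Set.disjoint_left.1 hAT h hi)
    simp [w, hi, this]
  have hw : ∀ i, i ∉ A → i ∉ T → w i = 0 := fun i h1 h2 => by simp [w, h1, h2]
  have key := fun f : MvPolynomial σ K => mem_span_X_pow_sup_iff (f := f) w hwA hwT hw
  have key' : ∀ f : MvPolynomial σ K, (∀ d ∈ f.support, e ≤ Finsupp.weight w d) ↔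
      (e : ℕ∞) ≤ (f : MvPowerSeries σ K).weightedOrder w := by
    intro f
    constructor
    · intro h
      refine MvPowerSeries.le_weightedOrder w fun d hd => ?_
      by_contra hne
      have := h d (by simpa using hne)
      exact absurd hd (not_lt.2 (by exact_mod_cast this))
    · intro h d hd
      have := h.trans (MvPowerSeries.weightedOrder_le w (d := d) (by simpa using hd))
      exact_mod_cast this
  rw [key, key'] at huh ⊢
  rw [coe_mul, MvPowerSeries.weightedOrder_mul] at huh
  have hu0 : (u : MvPowerSeries σ K).weightedOrder w = 0 := by
    rw [← Ideal.span_union, ← Set.image_union, mem_ideal_span_X_image] at hu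
    push Not at hu
    obtain ⟨d, hd, hd0⟩ := hu
    have := MvPowerSeries.weightedOrder_le w (d := d) (f := (u : MvPowerSeries σ K))
      (by simpa using hd)
    have hz : Finsupp.weight w d = 0 := by
      rw [Finsupp.weight_apply, Finsupp.sum]
      refine Finset.sum_eq_zero fun i _ => ?_
      by_cases h : i ∈ A ∪ T
      · simp [hd0 i h]
      · have : w i = 0 := hw i (fun h' => h (Or.inl h')) (fun h' => h (Or.inr h'))
        simp [this]
    rw [hz] at this
    simpa using this
  rwa [hu0, zero_add] at huh

theorem mem_span_X_of_X_mul_mem {A T : Set σ} (hAT : Disjoint A T) {e : ℕ} {i : σ} (hi : i ∈ A)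
    {h : MvPolynomial σ K}
    (hih : X i * h ∈ Ideal.span (X '' A : Set (MvPolynomial σ K)) ^ e ⊔ Ideal.span (X '' T)) :
    h ∈ Ideal.span (X '' A : Set (MvPolynomial σ K)) ^ (e - 1) ⊔ Ideal.span (X '' T) := by
  classical
  let w : ℕ → σ → ℕ := fun e i => if i ∈ A then 1 else if i ∈ T then e else 0
  have hwA : ∀ e, ∀ i ∈ A, w e i = 1 := fun e i hi => by simp [w, hi]
  have hwT : ∀ e, ∀ i ∈ T, w e i = e := fun e i hi => by
    have : i ∉ A := fun h => (Set.disjoint_left.1 hAT h hi)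
    simp [w, hi, this]
  have hw : ∀ e, ∀ i, i ∉ A → i ∉ T → w e i = 0 := fun e i h1 h2 => by simp [w, h1, h2]
  rw [mem_span_X_pow_sup_iff (w _) (hwA _) (hwT _) (hw _)] at hih ⊢
  intro d hd
  have h1 := hih (Finsupp.single i 1 + d) (by
    rw [mem_support_iff, coeff_X_mul]; exact mem_support_iff.1 hd)
  rw [map_add, Finsupp.weight_single, one_smul, hwA _ i hi] at h1
  -- The weights for `e` and `e - 1` differ only on `T`. A monomial involving `T` already has weight
  -- at least `e - 1`; on any other monomial the two weights agree.
  by_cases hT : ∃ j ∈ T, d j ≠ 0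
  · obtain ⟨j, hj, hdj⟩ := hT
    have := Finsupp.le_weight_of_ne_zero' (w (e - 1)) (f := d) hdj
    rwa [hwT _ j hj] at this
  · push Not at hT
    have : Finsupp.weight (w e) d = Finsupp.weight (w (e - 1)) d := by
      rw [Finsupp.weight_apply, Finsupp.weight_apply]
      refine Finset.sum_congr rfl fun j _ => ?_
      by_cases hj : j ∈ T
      · simp [hT j hj]
      · simp [w, hj]
    omega

theorem exists_algEquiv_map_span {S : Set (MvPolynomial σ K)}
    (hS : ∀ f ∈ S, f.IsHomogeneous 1) (hli : LinearIndepOn K id S) :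
    ∃ (τ : Set (σ →₀ K)) (φ : MvPolynomial σ K ≃ₐ[K] MvPolynomial τ K)
      (V : Set (MvPolynomial σ K) → Set τ),
      (∀ A ⊆ S, ∀ T ⊆ S, Disjoint A T → Disjoint (V A) (V T)) ∧
      (∀ A ⊆ S, ∀ f ∈ A, ∃ i ∈ V A, φ f = X i) ∧
      ∀ A ⊆ S, (Ideal.span A).map φ = Ideal.span (X '' V A) := by
  obtain ⟨τ, φ, v, hv, hφ⟩ := exists_algEquiv_X hS hli
  refine ⟨τ, φ, fun A => v '' {f | (f : MvPolynomial σ K) ∈ A}, ?_, ?_, ?_⟩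
  · intro A _ T _ hAT
    rw [Set.disjoint_image_iff hv, Set.disjoint_left]
    exact fun f hf hf' => Set.disjoint_left.1 hAT hf hf'
  · exact fun A hA f hf => ⟨v ⟨f, hA hf⟩, ⟨_, hf, rfl⟩, hφ ⟨f, hA hf⟩⟩
  · intro A hA
    rw [Ideal.map_span]
    congr 1
    ext p
    constructor
    · rintro ⟨f, hf, rfl⟩
      exact ⟨v ⟨f, hA hf⟩, ⟨_, hf, rfl⟩, (hφ ⟨f, hA hf⟩).symm⟩
    · rintro ⟨_, ⟨f, hf, rfl⟩, rfl⟩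
      exact ⟨f, hf, hφ f⟩

theorem mem_of_mul_mem_of_notMem {A T : Set (MvPolynomial σ K)}
    (hS : ∀ f ∈ A ∪ T, f.IsHomogeneous 1) (hli : LinearIndepOn K id (A ∪ T))
    (hAT : Disjoint A T) {e : ℕ} {u h : MvPolynomial σ K}
    (hu : u ∉ Ideal.span A ⊔ Ideal.span T)
    (huh : u * h ∈ Ideal.span A ^ e ⊔ Ideal.span T) :
    h ∈ Ideal.span A ^ e ⊔ Ideal.span T := by
  obtain ⟨τ, φ, V, hV, -, hspan⟩ := exists_algEquiv_map_span hS hli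
  have hmem : ∀ (I : Ideal (MvPolynomial σ K)) f, f ∈ I ↔ φ f ∈ I.map φ := fun I f => by
    refine ⟨Ideal.mem_map_of_mem φ, fun h => ?_⟩
    obtain ⟨g, hg, hgf⟩ := (Ideal.mem_map_of_equiv φ _).1 h
    exact φ.injective hgf ▸ hg
  rw [hmem, Ideal.map_sup, hspan A Set.subset_union_left, hspan T Set.subset_union_right] at hu
  rw [hmem, Ideal.map_sup, Ideal.map_pow, hspan A Set.subset_union_left,
    hspan T Set.subset_union_right] at huh ⊢
  rw [map_mul] at huh
  exact mem_span_X_of_mul_mem (hV _ Set.subset_union_left _ Set.subset_union_right hAT) hu huh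

theorem mem_of_linear_mul_mem {A T : Set (MvPolynomial σ K)}
    (hS : ∀ f ∈ A ∪ T, f.IsHomogeneous 1) (hli : LinearIndepOn K id (A ∪ T))
    (hAT : Disjoint A T) {e : ℕ} {l h : MvPolynomial σ K} (hl : l ∈ A)
    (hlh : l * h ∈ Ideal.span A ^ e ⊔ Ideal.span T) :
    h ∈ Ideal.span A ^ (e - 1) ⊔ Ideal.span T := by
  obtain ⟨τ, φ, V, hV, hX, hspan⟩ := exists_algEquiv_map_span hS hli
  have hmem : ∀ (I : Ideal (MvPolynomial σ K)) f, f ∈ I ↔ φ f ∈ I.map φ := fun I f => by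
    refine ⟨Ideal.mem_map_of_mem φ, fun h => ?_⟩
    obtain ⟨g, hg, hgf⟩ := (Ideal.mem_map_of_equiv φ _).1 h
    exact φ.injective hgf ▸ hg
  obtain ⟨i, hi, hli⟩ := hX A Set.subset_union_left l hl
  rw [hmem, Ideal.map_sup, Ideal.map_pow, hspan A Set.subset_union_left,
    hspan T Set.subset_union_right] at hlh ⊢
  rw [map_mul, hli] at hlh
  exact mem_span_X_of_X_mul_mem (hV _ Set.subset_union_left _ Set.subset_union_right hAT) hi hlh

theorem notMem_span_of_linearIndepOn_insert {A : Set (MvPolynomial σ K)}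
    {l : MvPolynomial σ K} (hS : ∀ f ∈ insert l A, f.IsHomogeneous 1)
    (hli : LinearIndepOn K id (insert l A)) (hl : l ∉ A) : l ∉ Ideal.span A := by
  obtain ⟨τ, φ, V, hV, hX, hspan⟩ := exists_algEquiv_map_span hS hli
  intro h
  have hsub := Set.subset_insert l A
  have h' := Ideal.mem_map_of_mem φ h
  obtain ⟨i, hi, hφ⟩ := hX {l} (by simp) l rfl
  rw [hspan A hsub, hφ, mem_ideal_span_X_image] at h'
  obtain ⟨j, hj, hne⟩ := h' (Finsupp.single i 1) (by
    classical rw [mem_support_iff, coeff_X, if_pos rfl]; exact one_ne_zero)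
  have hij : i = j := by
    by_contra hij
    exact hne (Finsupp.single_eq_of_ne (Ne.symm hij))
  exact Set.disjoint_left.1 (hV {l} (by simp) A hsub (by simpa using hl)) hi (hij ▸ hj)

theorem span_ne_top_of_isHomogeneous {A : Set (MvPolynomial σ K)}
    (hA : ∀ f ∈ A, f.IsHomogeneous 1) : Ideal.span A ≠ ⊤ := by
  have hle : Ideal.span A ≤ RingHom.ker (constantCoeff : MvPolynomial σ K →+* K) := by
    rw [Ideal.span_le]
    intro f hf
    rw [SetLike.mem_coe, RingHom.mem_ker, constantCoeff_eq]
    exact (hA f hf).coeff_eq_zero (by simp)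
  intro h
  rw [h] at hle
  have := hle (show (1 : MvPolynomial σ K) ∈ ⊤ from trivial)
  rw [RingHom.mem_ker, map_one] at this
  exact one_ne_zero this

theorem isPrime_span_of_linearIndepOn {A : Set (MvPolynomial σ K)}
    (hA : ∀ f ∈ A, f.IsHomogeneous 1) (hli : LinearIndepOn K id A) :
    (Ideal.span A).IsPrime := by
  refine ⟨span_ne_top_of_isHomogeneous hA, fun {x y} hxy => ?_⟩
  by_contra! h
  refine h.2 ?_
  simpa using mem_of_mul_mem_of_notMem (A := A) (T := ∅) (e := 1) (u := x) (h := y)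
    (by simpa using hA) (by simpa using hli) (by simp) (by simpa using h.1) (by simpa using hxy)

end LinearForms

/-- In the expansion of the power, every term except `J ^ n` has a factor in `I`. -/
theorem sup_pow_le_sup_pow {R : Type*} [CommRing R] (I J : Ideal R) (n : ℕ) :
    (I ⊔ J) ^ n ≤ I ⊔ J ^ n := by
  induction n with
  | zero => simp
  | succ n ih =>
    rw [pow_succ, pow_succ]
    refine (Ideal.mul_mono_left ih).trans ?_
    have h₁ : I * (I ⊔ J) ≤ I := Ideal.mul_le_left
    have h₂ : J ^ n * I ≤ I := Ideal.mul_le_right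
    rw [Ideal.sup_mul, Ideal.mul_sup (J ^ n)]
    exact sup_le (h₁.trans le_sup_left) (sup_le_sup_right h₂ _)

/-! ### Ideals generated by products of the forms -/

section FormIdeals

variable {σ K ι : Type*} [Field K] {ℓ : ι → MvPolynomial σ K}

/-- The ideal generated by the forms `ℓ i`, `i ∈ J`. -/
def formIdeal (ℓ : ι → MvPolynomial σ K) (J : Finset ι) : Ideal (MvPolynomial σ K) :=
  Ideal.span (ℓ '' J)

theorem mem_formIdeal {J : Finset ι} {i : ι} (hi : i ∈ J) : ℓ i ∈ formIdeal ℓ J :=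
  Ideal.subset_span ⟨i, hi, rfl⟩

@[simp]
theorem formIdeal_empty : formIdeal ℓ ∅ = ⊥ := by simp [formIdeal]

theorem formIdeal_mono {J J' : Finset ι} (h : J ⊆ J') : formIdeal ℓ J ≤ formIdeal ℓ J' :=
  Ideal.span_mono (Set.image_mono (by exact_mod_cast h))

theorem isPrime_formIdeal (hℓ : ∀ i, (ℓ i).IsHomogeneous 1) {J : Finset ι}
    (hli : LinearIndepOn K ℓ J) : (formIdeal ℓ J).IsPrime :=
  isPrime_span_of_linearIndepOn (by rintro _ ⟨i, -, rfl⟩; exact hℓ i) hli.id_image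

section

variable [Fintype ι]

/-- The ideal generated by the products `∏ i, ℓ i ^ a i` such that `∑ i ∈ J, (a i + k i) ≥ m` for
all `c`-element sets `J` disjoint from `T`. -/
def productIdeal (ℓ : ι → MvPolynomial σ K) (c : ℕ) (T : Finset ι) (m : ℕ) (k : ι → ℕ) :
    Ideal (MvPolynomial σ K) :=
  Ideal.span {g | ∃ a : ι → ℕ, (∀ J : Finset ι, J.card = c → Disjoint J T →
    m ≤ ∑ i ∈ J, (a i + k i)) ∧ g = ∏ i, ℓ i ^ a i}

theorem prod_pow_mem_productIdeal {c : ℕ} {T : Finset ι} {m : ℕ} {k a : ι → ℕ}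
    (ha : ∀ J : Finset ι, J.card = c → Disjoint J T → m ≤ ∑ i ∈ J, (a i + k i)) :
    ∏ i, ℓ i ^ a i ∈ productIdeal ℓ c T m k :=
  Ideal.subset_span ⟨a, ha, rfl⟩

theorem productIdeal_le_iff {c : ℕ} {T : Finset ι} {m : ℕ} {k : ι → ℕ}
    {I : Ideal (MvPolynomial σ K)} :
    productIdeal ℓ c T m k ≤ I ↔ ∀ a : ι → ℕ, (∀ J : Finset ι, J.card = c → Disjoint J T →
      m ≤ ∑ i ∈ J, (a i + k i)) → ∏ i, ℓ i ^ a i ∈ I := by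
  rw [productIdeal, Ideal.span_le]
  constructor
  · exact fun h a ha => h ⟨a, ha, rfl⟩
  · rintro h _ ⟨a, ha, rfl⟩
    exact h a ha

theorem productIdeal_eq_top {c : ℕ} {T : Finset ι} {m : ℕ} {k : ι → ℕ}
    (h : ∀ J : Finset ι, J.card = c → Disjoint J T → m ≤ ∑ i ∈ J, k i) :
    productIdeal ℓ c T m k = ⊤ := by
  rw [Ideal.eq_top_iff_one]
  have : (1 : MvPolynomial σ K) = ∏ i, ℓ i ^ (0 : ι → ℕ) i := by simp
  rw [this]
  exact prod_pow_mem_productIdeal (by simpa using h)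

end

variable [DecidableEq ι]

theorem formIdeal_union (J T : Finset ι) :
    formIdeal ℓ (J ∪ T) = formIdeal ℓ J ⊔ formIdeal ℓ T := by
  rw [formIdeal, Finset.coe_union, Set.image_union, Ideal.span_union]; rfl

theorem formIdeal_insert (i : ι) (T : Finset ι) :
    formIdeal ℓ (insert i T) = Ideal.span {ℓ i} ⊔ formIdeal ℓ T := by
  rw [Finset.insert_eq, formIdeal_union]; simp [formIdeal]

theorem disjoint_image_of_linearIndepOn {J T : Finset ι} (hJT : Disjoint J T)
    (hli : LinearIndepOn K ℓ ↑(J ∪ T)) : Disjoint (ℓ '' J) (ℓ '' T) := by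
  rw [Set.disjoint_left]
  rintro _ ⟨i, hi, rfl⟩ ⟨j, hj, hij⟩
  have := hli.injOn (show j ∈ (↑(J ∪ T) : Set ι) by simp [Finset.mem_coe.1 hj])
    (show i ∈ (↑(J ∪ T) : Set ι) by simp [Finset.mem_coe.1 hi]) hij
  exact Finset.disjoint_left.1 hJT hi (this ▸ hj)

theorem formIdeal_mem_of_mul_mem (hℓ : ∀ i, (ℓ i).IsHomogeneous 1) {J T : Finset ι}
    (hJT : Disjoint J T) (hli : LinearIndepOn K ℓ ↑(J ∪ T)) {e : ℕ} {u h : MvPolynomial σ K}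
    (hu : u ∉ formIdeal ℓ J ⊔ formIdeal ℓ T)
    (huh : u * h ∈ formIdeal ℓ J ^ e ⊔ formIdeal ℓ T) :
    h ∈ formIdeal ℓ J ^ e ⊔ formIdeal ℓ T := by
  refine mem_of_mul_mem_of_notMem ?_ ?_ (disjoint_image_of_linearIndepOn hJT hli) hu huh
  · rw [← Set.image_union]; rintro _ ⟨i, -, rfl⟩; exact hℓ i
  · rw [← Set.image_union, ← Finset.coe_union]; exact hli.id_image

theorem formIdeal_mem_of_form_mul_mem (hℓ : ∀ i, (ℓ i).IsHomogeneous 1) {J T : Finset ι}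
    (hJT : Disjoint J T) (hli : LinearIndepOn K ℓ ↑(J ∪ T)) {e : ℕ} {h : MvPolynomial σ K}
    {i : ι} (hi : i ∈ J) (hih : ℓ i * h ∈ formIdeal ℓ J ^ e ⊔ formIdeal ℓ T) :
    h ∈ formIdeal ℓ J ^ (e - 1) ⊔ formIdeal ℓ T := by
  refine mem_of_linear_mul_mem ?_ ?_ (disjoint_image_of_linearIndepOn hJT hli) ⟨i, hi, rfl⟩ hih
  · rw [← Set.image_union]; rintro _ ⟨i, -, rfl⟩; exact hℓ i
  · rw [← Set.image_union, ← Finset.coe_union]; exact hli.id_image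

theorem notMem_formIdeal (hℓ : ∀ i, (ℓ i).IsHomogeneous 1) {J : Finset ι} {i : ι} (hi : i ∉ J)
    (hli : LinearIndepOn K ℓ ↑(insert i J)) : ℓ i ∉ formIdeal ℓ J := by
  have himg : insert (ℓ i) (ℓ '' J) = ℓ '' ↑(insert i J) := by
    rw [Finset.coe_insert, Set.image_insert_eq]
  refine notMem_span_of_linearIndepOn_insert ?_ ?_ ?_
  · rw [himg]; rintro _ ⟨i, -, rfl⟩; exact hℓ i
  · rw [himg]; exact hli.id_image
  · rintro ⟨j, hj, hij⟩
    have := hli.injOn (by simp [Finset.mem_coe.1 hj]) (by simp) hij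
    exact hi (this ▸ hj)

variable [Fintype ι]

theorem prod_pow_mem_formIdeal_pow (J : Finset ι) (a : ι → ℕ) {e : ℕ} (he : e ≤ ∑ i ∈ J, a i) :
    ∏ i, ℓ i ^ a i ∈ formIdeal ℓ J ^ e := by
  rw [← Finset.prod_mul_prod_compl J]
  exact Ideal.mul_mem_right _ _
    (Ideal.pow_le_pow_right he (prod_pow_mem_pow_sum fun i hi => mem_formIdeal hi))

/-- Elements satisfying the order conditions `m - ∑ i ∈ J, k i` along the linear spaces
`ℓ i = 0`, `i ∈ J`, modulo the forms indexed by `T`, are combinations of products of the `ℓ i`. -/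
theorem mem_productIdeal_sup_of_forall_mem (hℓ : ∀ i, (ℓ i).IsHomogeneous 1) {n : ℕ}
    (hli : ∀ J : Finset ι, J.card ≤ n → LinearIndepOn K ℓ J) (c : ℕ) :
    ∀ (T : Finset ι), c + 1 + T.card ≤ n → ∀ (m : ℕ) (k : ι → ℕ) (f : MvPolynomial σ K),
      (∀ J : Finset ι, J.card = c → Disjoint J T →
        f ∈ formIdeal ℓ J ^ (m - ∑ i ∈ J, k i) ⊔ formIdeal ℓ T) →
      f ∈ productIdeal ℓ c T m k ⊔ formIdeal ℓ T := by
  have hsup : ∀ {A B C : Ideal (MvPolynomial σ K)}, A ≤ B → A ⊔ C ≤ B ⊔ C :=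
    fun h => sup_le_sup_right h _
  induction c with
  | zero =>
    intro T _ m k f hf
    rcases Nat.eq_zero_or_pos m with rfl | hm
    · rw [productIdeal_eq_top (by simp), top_sup_eq]
      trivial
    · have := hf ∅ rfl (by simp)
      simp only [formIdeal_empty, Finset.sum_empty, tsub_zero] at this
      rw [← Ideal.zero_eq_bot, zero_pow hm.ne', Ideal.zero_eq_bot, bot_sup_eq] at this
      exact Ideal.mem_sup_right this
  | succ c ih =>
    intro T hT m k
    -- `T` records the forms set to zero and `k` the powers already divided out. The inner induction
    -- is on the total deficit `μ`, the outer one on the size of the sets `J`.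
    generalize hμ : ∑ J : Finset ι, (m - ∑ i ∈ J, k i) = μ
    induction μ using Nat.strong_induction_on generalizing k with
    | _ μ ihμ =>
    intro f hf
    by_cases hex : ∃ J : Finset ι, J.card = c + 1 ∧ Disjoint J T ∧ ∑ i ∈ J, k i < m
    swap
    · push Not at hex
      rw [productIdeal_eq_top hex, top_sup_eq]
      trivial
    obtain ⟨J₀, hJ₀c, hJ₀T, hJ₀m⟩ := hex
    have hJ₀ne : J₀.Nonempty := Finset.card_pos.1 (by omega)
    -- Minimality of `k i` is used twice: products found modulo `ℓ i` then satisfy the original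
    -- conditions, and raising `k i` strictly lowers `μ`.
    obtain ⟨i, hiT, hmin⟩ := Finset.exists_min_image Tᶜ k (by
      obtain ⟨j, hj⟩ := hJ₀ne
      exact ⟨j, Finset.mem_compl.2 (Finset.disjoint_left.1 hJ₀T hj)⟩)
    rw [Finset.mem_compl] at hiT
    have hmin' : ∀ j ∉ T, k i ≤ k j := fun j hj => hmin j (Finset.mem_compl.2 hj)
    -- reduction modulo `ℓ i`
    have h1 := ih (insert i T) (by rw [Finset.card_insert_of_notMem hiT]; omega) (m - k i) k f (by
      intro J hJc hJd
      rw [Finset.disjoint_insert_right] at hJd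
      have := hf (insert i J) (by rw [Finset.card_insert_of_notMem hJd.1, hJc])
        (by rw [Finset.disjoint_insert_left]; exact ⟨hiT, hJd.2⟩)
      rw [Finset.sum_insert hJd.1, ← Nat.sub_sub, formIdeal_insert] at this
      rw [formIdeal_insert, ← sup_assoc]
      refine hsup ?_ this
      exact (sup_pow_le_sup_pow _ _ _).trans_eq (sup_comm _ _))
    rw [formIdeal_insert, ← sup_assoc, sup_right_comm] at h1
    obtain ⟨g, hg, y, hy, hgy⟩ := Submodule.mem_sup.1 h1
    obtain ⟨h, rfl⟩ := Ideal.mem_span_singleton'.1 hy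
    have hg' : g ∈ productIdeal ℓ (c + 1) T m k ⊔ formIdeal ℓ T := by
      refine hsup (productIdeal_le_iff.2 fun a ha => ?_) hg
      refine prod_pow_mem_productIdeal fun J hJc hJT => ?_
      -- Discarding one `j`, namely `i` itself if it lies in `J`, leaves a `c`-set to which the
      -- conditions modulo `ℓ i` apply; `k j ≥ k i` makes up for the lowered bound `m - k i`.
      obtain ⟨j, hjJ, hj⟩ : ∃ j ∈ J, i ∉ J.erase j := by
        by_cases hiJ : i ∈ J
        · exact ⟨i, hiJ, Finset.notMem_erase i J⟩
        · obtain ⟨j, hj⟩ : J.Nonempty := Finset.card_pos.1 (by omega)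
          exact ⟨j, hj, fun h => hiJ (Finset.mem_of_mem_erase h)⟩
      have h2 := ha (J.erase j) (by rw [Finset.card_erase_of_mem hjJ, hJc]; rfl) (by
        rw [Finset.disjoint_insert_right]
        exact ⟨hj, hJT.mono_left (Finset.erase_subset _ _)⟩)
      have h3 := hmin' j (Finset.disjoint_left.1 hJT hjJ)
      rw [← Finset.add_sum_erase J _ hjJ]
      omega
    -- the quotient by `ℓ i`
    let k' : ι → ℕ := k + Pi.single i 1
    have hk : ∀ J : Finset ι, ∑ j ∈ J, k' j = ∑ j ∈ J, k j + if i ∈ J then 1 else 0 := by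
      intro J
      simp [k', Finset.sum_add_distrib]
    have hh : h ∈ productIdeal ℓ (c + 1) T m k' ⊔ formIdeal ℓ T := by
      refine ihμ _ ?_ k' rfl h ?_
      · rw [← hμ]
        refine Finset.sum_lt_sum (fun J _ => ?_) ?_
        · rw [hk]; omega
        · obtain ⟨J, hiJ, hJ⟩ : ∃ J : Finset ι, i ∈ J ∧ ∑ j ∈ J, k j < m := by
            by_cases hi : i ∈ J₀
            · exact ⟨J₀, hi, hJ₀m⟩
            · obtain ⟨j, hj⟩ := hJ₀ne
              refine ⟨insert i (J₀.erase j), Finset.mem_insert_self _ _, ?_⟩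
              rw [Finset.sum_insert fun h => hi (Finset.mem_of_mem_erase h)]
              have := Finset.add_sum_erase J₀ k hj
              have := hmin' j (Finset.disjoint_left.1 hJ₀T hj)
              omega
          refine ⟨J, Finset.mem_univ _, ?_⟩
          rw [hk, if_pos hiJ]; omega
      · intro J hJc hJT
        have hcard : (J ∪ T).card ≤ n := (Finset.card_union_le J T).trans (by omega)
        have hmem : ℓ i * h ∈ formIdeal ℓ J ^ (m - ∑ i ∈ J, k i) ⊔ formIdeal ℓ T := by
          have : ℓ i * h = f - g := by rw [← hgy]; ring
          rw [this]
          refine sub_mem (hf J hJc hJT) ?_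
          refine hsup (productIdeal_le_iff.2 fun a ha => ?_) hg'
          refine prod_pow_mem_formIdeal_pow J a ?_
          have := ha J hJc hJT
          rw [Finset.sum_add_distrib] at this
          omega
        rw [hk]
        by_cases hi : i ∈ J
        · rw [if_pos hi, ← Nat.sub_sub]
          exact formIdeal_mem_of_form_mul_mem hℓ hJT (hli _ hcard) hi hmem
        · rw [if_neg hi, add_zero]
          refine formIdeal_mem_of_mul_mem hℓ hJT (hli _ hcard) ?_ hmem
          rw [← formIdeal_union]
          have : i ∉ J ∪ T := by simp [hi, hiT]
          refine notMem_formIdeal hℓ this (hli _ ?_)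
          rw [Finset.card_insert_of_notMem this]
          have := Finset.card_union_le J T
          omega
    rw [← hgy]
    refine add_mem hg' ?_
    obtain ⟨p, hp, t, ht, rfl⟩ := Submodule.mem_sup.1 hh
    rw [add_mul]
    refine add_mem (Ideal.mem_sup_left ?_)
      (Ideal.mem_sup_right (Ideal.mul_mem_right _ _ ht))
    have hle : productIdeal ℓ (c + 1) T m k' ≤
        Submodule.comap (LinearMap.mulRight (MvPolynomial σ K) (ℓ i))
          (productIdeal ℓ (c + 1) T m k) := by
      refine productIdeal_le_iff.2 fun a ha => ?_
      rw [Submodule.mem_comap, LinearMap.mulRight_apply]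
      have : (∏ j, ℓ j ^ a j) * ℓ i = ∏ j, ℓ j ^ (a + Pi.single i 1 : ι → ℕ) j := by
        simp only [Pi.add_apply, pow_add, Finset.prod_mul_distrib]
        congr 1
        rw [Finset.prod_eq_single i]
        · simp
        · intro j _ hj; simp [hj]
        · simp
      rw [this]
      refine prod_pow_mem_productIdeal fun J hJc hJT => ?_
      refine (ha J hJc hJT).trans_eq (Finset.sum_congr rfl fun j _ => ?_)
      simp only [k', Pi.add_apply]; ring
    exact hle hp

theorem mem_productIdeal_of_forall_mem (hℓ : ∀ i, (ℓ i).IsHomogeneous 1) {c : ℕ}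
    (hli : ∀ J : Finset ι, J.card ≤ c + 1 → LinearIndepOn K ℓ J) {m : ℕ}
    {f : MvPolynomial σ K} (hf : ∀ J : Finset ι, J.card = c → f ∈ formIdeal ℓ J ^ m) :
    f ∈ productIdeal ℓ c ∅ m 0 := by
  simpa using mem_productIdeal_sup_of_forall_mem hℓ hli c ∅ (by simp) m 0 f
    (by simpa using hf)

end FormIdeals

/-! ### Proper arrangements and symbolic powers -/

section Arrangements

variable {K : Type*} [Field K] {N s : ℕ} {ℓ : Fin s → MvPolynomial (Fin (N + 1)) K}

/-- At most `N` forms cannot span the `N + 1` variables. This is what makes their ideal a point of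
`Proj`. -/
theorem exists_X_notMem_formIdeal (hℓ : ∀ i, (ℓ i).IsHomogeneous 1) {J : Finset (Fin s)}
    (hli : LinearIndepOn K ℓ J) (hJ : J.card ≤ N) :
    ∃ k : Fin (N + 1), (X k : MvPolynomial (Fin (N + 1)) K) ∉ formIdeal ℓ J := by
  classical
  obtain ⟨k, hk⟩ : ∃ k : Fin (N + 1),
      (X k : MvPolynomial (Fin (N + 1)) K) ∉ Submodule.span K (ℓ '' J) := by
    by_contra! h
    have h1 := linearIndependent_le_span_aux' X (linearIndependent_X (Fin (N + 1)) K)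
      (↑(J.image ℓ)) (by
        rintro _ ⟨k, rfl⟩
        rw [Finset.coe_image]
        exact h k)
    have h2 := Finset.card_image_le (s := J) (f := ℓ)
    simp only [Fintype.card_fin, Finset.coe_sort_coe, Fintype.card_coe] at h1
    omega
  refine ⟨k, notMem_span_of_linearIndepOn_insert (A := ℓ '' J) ?_ ?_ ?_⟩
  · rintro f (rfl | ⟨i, -, rfl⟩)
    · exact isHomogeneous_X K k
    · exact hℓ i
  · exact hli.id_image.insert (by simpa using hk)
  · exact fun h => hk (Submodule.subset_span h)

/-- The point of `ℙ^N` given by at most `N` independent linear forms. -/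
def formPoint (hℓ : ∀ i, (ℓ i).IsHomogeneous 1) (J : Finset (Fin s))
    (hli : LinearIndepOn K ℓ J) (hJ : J.card ≤ N) : PSpace K N where
  asHomogeneousIdeal := ⟨formIdeal ℓ J, Ideal.homogeneous_span _ _ (by
    rintro _ ⟨i, -, rfl⟩
    exact ⟨1, (mem_homogeneousSubmodule 1 _).2 (hℓ i)⟩)⟩
  isPrime := isPrime_formIdeal hℓ hli
  not_irrelevant_le := by
    intro h
    obtain ⟨k, hk⟩ := exists_X_notMem_formIdeal hℓ hli hJ
    refine hk (h ?_)
    change (X k : MvPolynomial (Fin (N + 1)) K) ∈ HomogeneousIdeal.irrelevant (grading K N)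
    rw [HomogeneousIdeal.mem_irrelevant_iff, GradedRing.proj_apply]
    exact DirectSum.decompose_of_mem_ne _
      ((mem_homogeneousSubmodule 1 _).2 (isHomogeneous_X K k)) one_ne_zero

theorem mem_iInter_hyperplane {J : Finset (Fin s)} {x : PSpace K N} :
    x ∈ ⋂ i ∈ J, hyperplane (ℓ i) ↔ formIdeal ℓ J ≤ x.asHomogeneousIdeal.toIdeal := by
  simp only [Set.mem_iInter, hyperplane, ProjectiveSpectrum.mem_zeroLocus,
    Set.singleton_subset_iff, formIdeal, Ideal.span_le, Set.image_subset_iff]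
  rfl

theorem mem_definingIdeal {Z : Set (PSpace K N)} {f : MvPolynomial (Fin (N + 1)) K} :
    f ∈ definingIdeal Z ↔ ∀ x ∈ Z, f ∈ x.asHomogeneousIdeal.toIdeal :=
  ProjectiveSpectrum.mem_vanishingIdeal _ _

theorem formPoint_mem (hℓ : ∀ i, (ℓ i).IsHomogeneous 1) {J J' : Finset (Fin s)}
    (hli : LinearIndepOn K ℓ J') (hJ : J'.card ≤ N) (hJJ' : formIdeal ℓ J ≤ formIdeal ℓ J') :
    formPoint hℓ J' hli hJ ∈ ⋂ i ∈ J, hyperplane (ℓ i) :=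
  mem_iInter_hyperplane.2 hJJ'

theorem definingIdeal_iInter_hyperplane (hℓ : ∀ i, (ℓ i).IsHomogeneous 1)
    {J J' : Finset (Fin s)} (hli : LinearIndepOn K ℓ J') (hJ : J'.card ≤ N)
    (hJJ' : formIdeal ℓ J = formIdeal ℓ J') :
    definingIdeal (⋂ i ∈ J, hyperplane (ℓ i)) = formIdeal ℓ J := by
  refine le_antisymm (fun f hf => ?_) fun f hf => ?_
  · rw [hJJ']
    exact mem_definingIdeal.1 hf _ (formPoint_mem hℓ hli hJ hJJ'.le)
  · exact mem_definingIdeal.2 fun x hx => mem_iInter_hyperplane.1 hx hf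

/-- Each `formIdeal ℓ J` is itself a point of the star configuration, the generic point of its
linear component, so no Nullstellensatz is needed. -/
theorem mem_definingIdeal_starConfiguration (hℓ : ∀ i, (ℓ i).IsHomogeneous 1) {c : ℕ}
    (hc : c ≤ N) (hli : ∀ J : Finset (Fin s), J.card = c → LinearIndepOn K ℓ J)
    {f : MvPolynomial (Fin (N + 1)) K} :
    f ∈ definingIdeal (starConfiguration ℓ c) ↔
      ∀ J : Finset (Fin s), J.card = c → f ∈ formIdeal ℓ J := by
  rw [mem_definingIdeal]
  constructor
  · intro h J hJ
    exact h (formPoint hℓ J (hli J hJ) (hJ.trans_le hc))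
      (Set.mem_biUnion hJ (formPoint_mem hℓ _ _ le_rfl))
  · intro h x hx
    obtain ⟨J, hJ, hxJ⟩ := Set.mem_iUnion₂.1 hx
    exact mem_iInter_hyperplane.1 hxJ (h J hJ)

/-- If `J` were dependent, a maximal independent `J' ⊂ J` would generate the same ideal with at most
`N` forms. The intersection is then nonempty, and Krull's height theorem bounds its codimension by
`J'.card < J.card`. -/
theorem IsProperArrangement.linearIndepOn (hℓ : IsProperArrangement ℓ) {J : Finset (Fin s)}
    (hJ : J.card ≤ N + 1) : LinearIndepOn K ℓ J := by
  classical
  by_contra hdep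
  obtain ⟨b, hbJ, -, hspan, hb⟩ := exists_linearIndepOn_extension
    (linearIndepOn_empty K ℓ) (Set.empty_subset (J : Set (Fin s)))
  obtain ⟨J', rfl⟩ : ∃ J' : Finset (Fin s), (J' : Set (Fin s)) = b :=
    ⟨b.toFinset, by simp⟩
  have hsub : J' ⊂ J := by
    refine lt_of_le_of_ne (by exact_mod_cast hbJ) ?_
    rintro rfl
    exact hdep hb
  have hcard := Finset.card_lt_card hsub
  have hJ' : J'.card ≤ N := by omega
  have heq : formIdeal ℓ J = formIdeal ℓ J' := by
    refine le_antisymm ?_ (formIdeal_mono hsub.subset)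
    refine Ideal.span_le.2 fun f hf => ?_
    have h1 : Submodule.span K (ℓ '' J') ≤ (formIdeal ℓ J').restrictScalars K :=
      Submodule.span_le.2 Ideal.subset_span
    exact h1 (hspan hf)
  have := isPrime_formIdeal hℓ.linear hb
  rcases hℓ.proper J with h | h
  · have := formPoint_mem hℓ.linear hb hJ' heq.le
    rw [h] at this
    exact this
  · rw [codim, definingIdeal_iInter_hyperplane hℓ.linear hb hJ' heq, heq] at h
    have h1 : (formIdeal ℓ J').height ≤ (J'.image ℓ).card := by
      refine Ideal.height_le_card_of_mem_minimalPrimes_span_finset ?_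
      rw [Finset.coe_image]
      change formIdeal ℓ J' ∈ (formIdeal ℓ J').minimalPrimes
      rw [Ideal.minimalPrimes_eq_subsingleton_self]
      rfl
    rw [h] at h1
    have h2 : J.card ≤ (J'.image ℓ).card := by exact_mod_cast h1
    have h3 := Finset.card_image_le (s := J') (f := ℓ)
    omega

/-- The product `g J` of the forms outside `J` avoids `P_J` but lies in every other component, so
`P_J` is the annihilator of `g J` modulo `I`, hence associated. Every associated prime lies in some
`P_J`. -/
theorem mem_symbolicPower_iff_of_forall (hℓ : ∀ i, (ℓ i).IsHomogeneous 1) {c : ℕ}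
    (hli : ∀ J : Finset (Fin s), J.card ≤ c + 1 → LinearIndepOn K ℓ J)
    {I : Ideal (MvPolynomial (Fin (N + 1)) K)}
    (hI : ∀ f, f ∈ I ↔ ∀ J : Finset (Fin s), J.card = c → f ∈ formIdeal ℓ J) {m : ℕ}
    {f : MvPolynomial (Fin (N + 1)) K} :
    f ∈ symbolicPower I m ↔ ∀ J : Finset (Fin s), J.card = c → f ∈ formIdeal ℓ J ^ m := by
  classical
  have hli' : ∀ J : Finset (Fin s), J.card = c → LinearIndepOn K ℓ J := fun J hJ =>
    hli J (by omega)
  have hprime : ∀ J : Finset (Fin s), J.card = c → (formIdeal ℓ J).IsPrime := fun J hJ =>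
    isPrime_formIdeal hℓ (hli' J hJ)
  let g : Finset (Fin s) → MvPolynomial (Fin (N + 1)) K := fun J => ∏ i ∈ Jᶜ, ℓ i
  have hg : ∀ J : Finset (Fin s), J.card = c → g J ∉ formIdeal ℓ J := by
    intro J hJ h
    obtain ⟨i, hi, hiJ⟩ := ((hprime J hJ).prod_mem_iff).1 h
    have hi := Finset.mem_compl.1 hi
    exact notMem_formIdeal hℓ hi (hli _ (by rw [Finset.card_insert_of_notMem hi, hJ])) hiJ
  have hg' : ∀ J J' : Finset (Fin s), J.card = c → J'.card = c → J ≠ J' →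
      g J ∈ formIdeal ℓ J' := by
    intro J J' hJ hJ' hne
    obtain ⟨i, hi, hiJ⟩ : ∃ i ∈ J', i ∉ J := by
      by_contra! h
      exact hne (Finset.eq_of_subset_of_card_le h (by omega)).symm
    exact Ideal.mem_of_dvd _ (Finset.dvd_prod_of_mem ℓ (Finset.mem_compl.2 hiJ))
      (mem_formIdeal hi)
  have hmulI : ∀ J : Finset (Fin s), J.card = c → ∀ p, p * g J ∈ I ↔ p ∈ formIdeal ℓ J := by
    intro J hJ p
    rw [hI]
    constructor
    · exact fun h => ((hprime J hJ).mem_or_mem (h J hJ)).resolve_right (hg J hJ)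
    · intro h J' hJ'
      by_cases hne : J = J'
      · exact hne ▸ Ideal.mul_mem_right _ _ h
      · exact Ideal.mul_mem_left _ _ (hg' J J' hJ hJ' hne)
  have hle : ∀ J : Finset (Fin s), J.card = c → I ≤ formIdeal ℓ J := fun J hJ p hp =>
    (hI p).1 hp J hJ
  have hmem : f ∈ symbolicPower I m ↔
      ∀ P ∈ associatedPrimes (MvPolynomial (Fin (N + 1)) K) (MvPolynomial (Fin (N + 1)) K ⧸ I),
        ∃ u ∉ P, u * f ∈ I ^ m := by
    simp only [symbolicPower, Ideal.mem_iInf, Subtype.forall]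
    refine forall₂_congr fun P hP => ?_
    have := hP.isPrime
    rw [Ideal.mem_comap, IsLocalization.algebraMap_mem_map_algebraMap_iff P.primeCompl]
    rfl
  have hcolon : ∀ p x : MvPolynomial (Fin (N + 1)) K,
      p ∈ (⊥ : Submodule (MvPolynomial (Fin (N + 1)) K)
        (MvPolynomial (Fin (N + 1)) K ⧸ I)).colon {Ideal.Quotient.mk I x} ↔ p * x ∈ I := by
    intro p x
    rw [Submodule.mem_colon_singleton, Submodule.mem_bot, ← Ideal.Quotient.eq_zero_iff_mem,
      map_mul]
    rfl
  rw [hmem]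
  constructor
  · intro h J hJ
    have hass : formIdeal ℓ J ∈ associatedPrimes (MvPolynomial (Fin (N + 1)) K)
        (MvPolynomial (Fin (N + 1)) K ⧸ I) := by
      refine isAssociatedPrime_iff.2 ⟨hprime J hJ, Ideal.Quotient.mk I (g J), ?_⟩
      ext p
      rw [hcolon, hmulI J hJ]
    obtain ⟨u, hu, huf⟩ := h _ hass
    -- Powers of `P_J` are primary, so the multiplier `u` can be cancelled.
    have h1 := formIdeal_mem_of_mul_mem (T := ∅) hℓ (Finset.disjoint_empty_right J)
      (by simpa using hli' J hJ) (e := m) (by simpa using hu)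
      (by simpa using Ideal.pow_right_mono (hle J hJ) m huf)
    simpa using h1
  · intro h P hP
    obtain ⟨hP1, y, hPy⟩ := isAssociatedPrime_iff.1 hP
    obtain ⟨x, rfl⟩ := Ideal.Quotient.mk_surjective y
    have hPx : ∀ p, p ∈ P ↔ p * x ∈ I := fun p => by rw [← hcolon, ← hPy]
    obtain ⟨J, hJ, hxJ⟩ : ∃ J : Finset (Fin s), J.card = c ∧ x ∉ formIdeal ℓ J := by
      by_contra! hx
      refine hP1.ne_top ((Ideal.eq_top_iff_one _).2 ?_)
      rw [hPx, one_mul, hI]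
      exact hx
    have hPJ : P ≤ formIdeal ℓ J := fun p hp =>
      ((hprime J hJ).mem_or_mem (hle J hJ ((hPx p).1 hp))).resolve_right hxJ
    -- From `g J * P_J ≤ I` it follows that `g J ^ m` carries `P_J ^ m` into `I ^ m`.
    refine ⟨g J ^ m, fun hgm => hg J hJ ((hprime J hJ).mem_of_pow_mem m (hPJ hgm)), ?_⟩
    have h1 : Ideal.span {g J} * formIdeal ℓ J ≤ I := by
      rw [Ideal.span_singleton_mul_le_iff]
      intro p hp
      rw [mul_comm, hmulI J hJ]
      exact hp
    refine Ideal.pow_right_mono h1 m ?_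
    rw [mul_pow]
    exact Ideal.mul_mem_mul (Ideal.pow_mem_pow (Ideal.mem_span_singleton_self _) m) (h J hJ)

end Arrangements

/-! ### Combinatorics of exponent vectors -/

section Exponents

variable {ι : Type*} [Fintype ι] [DecidableEq ι]

/-- If `c` exponents were at most `m - 1`, their sum would be below `D`. For the total, `s - c` of
the large exponents contribute at least `m` each, and the complementary `c` contribute at least `D`,
where `s` is the size of `ι`. -/
theorem exists_large_exponents {a : ι → ℕ} {c m D : ℕ} (hc : 1 ≤ c) (hcs : c ≤ Fintype.card ι)
    (hm : 1 ≤ m) (hD : c * (m - 1) + 1 ≤ D) (ha : ∀ J : Finset ι, J.card = c → D ≤ ∑ i ∈ J, a i) :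
    ∃ A : Finset ι, A.card = Fintype.card ι - c + 1 ∧ (∀ i ∈ A, m ≤ a i) ∧
      D + m * (Fintype.card ι - c) ≤ ∑ i, a i := by
  let B : Finset ι := Finset.univ.filter fun i => a i < m
  have hB : B.card < c := by
    by_contra! h
    obtain ⟨J, hJB, hJ⟩ := Finset.exists_subset_card_eq h
    have h1 : ∑ i ∈ J, a i ≤ J.card • (m - 1) := Finset.sum_le_card_nsmul _ _ _ fun i hi => by
      have := (Finset.mem_filter.1 (hJB hi)).2
      omega
    have h2 := ha J hJ
    rw [hJ, smul_eq_mul] at h1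
    omega
  obtain ⟨A, hAB, hA⟩ := Finset.exists_subset_card_eq
    (show Fintype.card ι - c + 1 ≤ Bᶜ.card by rw [Finset.card_compl]; omega)
  have hAm : ∀ i ∈ A, m ≤ a i := fun i hi => by
    have := Finset.mem_compl.1 (hAB hi)
    simpa [B] using this
  refine ⟨A, hA, hAm, ?_⟩
  obtain ⟨i₀, hi₀⟩ : A.Nonempty := Finset.card_pos.1 (by omega)
  have hcard : (A.erase i₀).card = Fintype.card ι - c := by
    rw [Finset.card_erase_of_mem hi₀, hA]; rfl
  rw [← Finset.sum_add_sum_compl (A.erase i₀), add_comm]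
  refine add_le_add ?_ (ha _ (by rw [Finset.card_compl, hcard]; omega))
  rw [← hcard, mul_comm, ← smul_eq_mul]
  exact Finset.card_nsmul_le_sum _ _ _ fun i hi => hAm i (Finset.mem_of_mem_erase hi)

/-- Take a `c`-set of smallest sum. By exchange, each exponent outside it dominates every exponent
inside, so `c` times it is at least `t`. -/
theorem mul_card_le_mul_sum {a : ι → ℕ} {c t : ℕ} (hcs : c ≤ Fintype.card ι)
    (ha : ∀ J : Finset ι, J.card = c → t ≤ ∑ i ∈ J, a i) :
    t * Fintype.card ι ≤ c * ∑ i, a i := by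
  obtain ⟨J, hJ, hmin⟩ := Finset.exists_min_image (Finset.powersetCard c (Finset.univ : Finset ι))
    (fun J => ∑ i ∈ J, a i) (Finset.powersetCard_nonempty.2 (by simpa using hcs))
  have hJ := (Finset.mem_powersetCard.1 hJ).2
  have hswap : ∀ j ∈ Jᶜ, t ≤ c * a j := by
    intro j hj
    have hj := Finset.mem_compl.1 hj
    refine (ha J hJ).trans ?_
    rw [← hJ, ← smul_eq_mul]
    refine Finset.sum_le_card_nsmul _ _ _ fun i hi => ?_
    have hj' : j ∉ J.erase i := fun h => hj (Finset.mem_of_mem_erase h)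
    have h1 := hmin (insert j (J.erase i)) (Finset.mem_powersetCard.2 ⟨Finset.subset_univ _, by
      rw [Finset.card_insert_of_notMem hj', Finset.card_erase_add_one hi, hJ]⟩)
    rw [Finset.sum_insert hj', ← Finset.add_sum_erase J a hi] at h1
    omega
  have h1 : Jᶜ.card • t ≤ ∑ j ∈ Jᶜ, c * a j := Finset.card_nsmul_le_sum _ _ _ hswap
  have h2 := Nat.mul_le_mul_left c (ha J hJ)
  rw [Finset.card_compl, hJ, smul_eq_mul, ← Finset.mul_sum] at h1
  rw [← Finset.sum_add_sum_compl J, mul_add]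
  obtain ⟨d, hd⟩ := Nat.exists_eq_add_of_le hcs
  rw [hd, Nat.add_sub_cancel_left] at h1
  rw [hd]
  linarith [mul_add t c d, mul_comm t c, mul_comm t d]

theorem exists_balanced_exponents {c m : ℕ} (hc : 1 ≤ c) (hcs : c ≤ Fintype.card ι) (hm : 1 ≤ m) :
    ∃ b : ι → ℕ, (∀ J : Finset ι, J.card = c → m ≤ ∑ i ∈ J, b i) ∧
      c * (∑ i, b i + (c - 1)) ≤ Fintype.card ι * (m + (c - 1)) := by
  obtain ⟨q, r, hqr, hr, hq⟩ : ∃ q r, q * c = m + r ∧ r ≤ c - 1 ∧ 1 ≤ q := by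
    -- `q` is `m / c` rounded up and `r` the excess `q * c - m`; lowering `r` of the exponents from
    -- `q` to `q - 1` costs any `c`-set at most `r`.
    refine ⟨(m + (c - 1)) / c, (m + (c - 1)) / c * c - m, ?_, ?_, ?_⟩
    · have := Nat.div_add_mod' (m + (c - 1)) c
      have := Nat.mod_lt (m + (c - 1)) hc
      omega
    · have := Nat.div_mul_le_self (m + (c - 1)) c
      omega
    · rw [Nat.one_le_div_iff hc]; omega
  obtain ⟨B, -, hB⟩ := Finset.exists_subset_card_eq
    (show r ≤ (Finset.univ : Finset ι).card by rw [Finset.card_univ]; omega)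
  let b : ι → ℕ := fun i => if i ∈ B then q - 1 else q
  have hsum : ∀ J : Finset ι, ∑ i ∈ J, b i + (J ∩ B).card = q * J.card := by
    intro J
    rw [← Finset.filter_mem_eq_inter, Finset.card_filter, ← Finset.sum_add_distrib, mul_comm,
      ← smul_eq_mul, ← Finset.sum_const]
    refine Finset.sum_congr rfl fun i _ => ?_
    by_cases h : i ∈ B
    · simp only [b, h, if_true]; omega
    · simp [b, h]
  refine ⟨b, fun J hJ => ?_, ?_⟩
  · have h1 := hsum J
    have h2 := Finset.card_le_card (Finset.inter_subset_right (s₁ := J) (s₂ := B))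
    rw [hJ] at h1
    omega
  · have h1 := hsum Finset.univ
    rw [Finset.univ_inter, hB, Finset.card_univ] at h1
    obtain ⟨d, hd⟩ := Nat.exists_eq_add_of_le hcs
    obtain ⟨c, rfl⟩ := Nat.exists_eq_add_of_le' hc
    rw [Nat.add_sub_cancel] at *
    rw [hd] at h1 ⊢
    -- After substitution the claim is `(s - c) * r ≤ (s - c) * (c - 1)`, with `s` the size of `ι`
    -- and `c` in its original meaning.
    nlinarith

end Exponents

/-! ### Containments and initial degrees -/

section SymbolicPowers

variable {K : Type*} [Field K] {N s : ℕ} {ℓ : Fin s → MvPolynomial (Fin (N + 1)) K}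

theorem mem_irrelevantIdeal_of_isHomogeneous {f : MvPolynomial (Fin (N + 1)) K}
    (hf : f.IsHomogeneous 1) : f ∈ irrelevantIdeal K N := by
  have h1 := (mem_homogeneousSubmodule 1 f).2 hf
  rw [homogeneousSubmodule_one_eq_span_X] at h1
  have h2 : Submodule.span K (Set.range X) ≤ (irrelevantIdeal K N).restrictScalars K :=
    Submodule.span_le.2 Ideal.subset_span
  exact h2 h1

theorem prod_pow_mem_irrelevantIdeal_pow (hℓ : ∀ i, (ℓ i).IsHomogeneous 1) (a : Fin s → ℕ) {d : ℕ}
    (hd : d ≤ ∑ i, a i) : ∏ i, ℓ i ^ a i ∈ irrelevantIdeal K N ^ d :=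
  Ideal.pow_le_pow_right hd
    (prod_pow_mem_pow_sum fun i _ => mem_irrelevantIdeal_of_isHomogeneous (hℓ i))

theorem le_totalDegree_of_mem_irrelevantIdeal_pow {d : ℕ} {f : MvPolynomial (Fin (N + 1)) K}
    (hf : f ∈ irrelevantIdeal K N ^ d) (hf0 : f ≠ 0) : d ≤ f.totalDegree := by
  obtain ⟨e, he⟩ := support_nonempty.2 hf0
  exact ((mem_pow_idealOfVars_iff d f).1 hf e he).trans (le_totalDegree he)

/-- The ideal `I` is the intersection of the ideals generated by `c` of the forms `ℓ i`, any `c + 1`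
of which are linearly independent. -/
structure IsStarIdeal (ℓ : Fin s → MvPolynomial (Fin (N + 1)) K) (c : ℕ)
    (I : Ideal (MvPolynomial (Fin (N + 1)) K)) : Prop where
  linear : ∀ i, (ℓ i).IsHomogeneous 1
  ne_zero : ∀ i, ℓ i ≠ 0
  linearIndepOn : ∀ J : Finset (Fin s), J.card ≤ c + 1 → LinearIndepOn K ℓ J
  mem_iff : ∀ f, f ∈ I ↔ ∀ J : Finset (Fin s), J.card = c → f ∈ formIdeal ℓ J

variable {c : ℕ} {I : Ideal (MvPolynomial (Fin (N + 1)) K)}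

theorem IsProperArrangement.isStarIdeal (hℓ : IsProperArrangement ℓ) (hc : c ≤ N) :
    IsStarIdeal ℓ c (definingIdeal (starConfiguration ℓ c)) where
  linear := hℓ.linear
  ne_zero := hℓ.ne_zero
  linearIndepOn _ hJ := hℓ.linearIndepOn (by omega)
  mem_iff _ := mem_definingIdeal_starConfiguration hℓ.linear hc
    fun _ hJ => hℓ.linearIndepOn (by omega)

theorem IsStarIdeal.mem_symbolicPower_iff (h : IsStarIdeal ℓ c I) {m : ℕ}
    {f : MvPolynomial (Fin (N + 1)) K} :
    f ∈ symbolicPower I m ↔ ∀ J : Finset (Fin s), J.card = c → f ∈ formIdeal ℓ J ^ m :=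
  mem_symbolicPower_iff_of_forall h.linear h.linearIndepOn h.mem_iff

theorem IsStarIdeal.symbolicPower_one (h : IsStarIdeal ℓ c I) : symbolicPower I 1 = I := by
  ext f
  rw [h.mem_symbolicPower_iff, h.mem_iff]
  simp only [pow_one]

theorem IsStarIdeal.symbolicPower_le_of_forall (h : IsStarIdeal ℓ c I) {m : ℕ}
    {Q : Ideal (MvPolynomial (Fin (N + 1)) K)}
    (hQ : ∀ a : Fin s → ℕ, (∀ J : Finset (Fin s), J.card = c → m ≤ ∑ i ∈ J, a i) →
      ∏ i, ℓ i ^ a i ∈ Q) : symbolicPower I m ≤ Q := fun _ hf =>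
  productIdeal_le_iff.2 (fun a ha => hQ a (by simpa using ha))
    (mem_productIdeal_of_forall_mem h.linear h.linearIndepOn (h.mem_symbolicPower_iff.1 hf))

theorem IsStarIdeal.symbolicPower_le (h : IsStarIdeal ℓ c I) (hc : 1 ≤ c) (hcs : c ≤ s) {m D : ℕ}
    (hm : 1 ≤ m) (hD : c * (m - 1) + 1 ≤ D) :
    symbolicPower I D ≤ irrelevantIdeal K N ^ (D - m) * I ^ m := by
  refine h.symbolicPower_le_of_forall fun a ha => ?_
  obtain ⟨A, hA, hAm, hsum⟩ := exists_large_exponents hc (by simpa using hcs) hm hD ha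
  rw [Fintype.card_fin] at hA hsum
  have hAI : ∏ i ∈ A, ℓ i ∈ I := by
    rw [h.mem_iff]
    intro J hJ
    obtain ⟨i, hi⟩ : (A ∩ J).Nonempty := by
      rw [← Finset.card_pos]
      have h1 := Finset.card_union_add_card_inter A J
      have h2 := Finset.card_le_univ (A ∪ J)
      rw [Fintype.card_fin] at h2
      omega
    rw [Finset.mem_inter] at hi
    exact Ideal.mem_of_dvd _ (Finset.dvd_prod_of_mem ℓ hi.1) (mem_formIdeal hi.2)
  let e : Fin s → ℕ := fun i => if i ∈ A then m else 0
  have hle : ∀ i, e i ≤ a i := by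
    intro i
    by_cases hi : i ∈ A
    · simpa [e, hi] using hAm i hi
    · simp [e, hi]
  have hprod : ∏ i, ℓ i ^ e i = (∏ i ∈ A, ℓ i) ^ m := by
    rw [← Finset.prod_pow]
    simp only [e, pow_ite, pow_zero, Finset.prod_ite_mem, Finset.univ_inter]
  have hesum : ∑ i, e i = (s - c + 1) * m := by
    simp [e, Finset.sum_ite_mem, hA]
  have hsplit : ∏ i, ℓ i ^ a i = (∏ i, ℓ i ^ (a i - e i)) * (∏ i ∈ A, ℓ i) ^ m := by
    rw [← hprod, ← Finset.prod_mul_distrib]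
    refine Finset.prod_congr rfl fun i _ => ?_
    rw [← pow_add, Nat.sub_add_cancel (hle i)]
  rw [hsplit]
  refine Ideal.mul_mem_mul (prod_pow_mem_irrelevantIdeal_pow h.linear _ ?_)
    (Ideal.pow_mem_pow hAI m)
  rw [Finset.sum_tsub_distrib _ fun i _ => hle i, hesum, add_mul, mul_comm (s - c) m]
  omega

theorem IsStarIdeal.mul_le_mul_totalDegree (h : IsStarIdeal ℓ c I) (hc : 1 ≤ c) (hcs : c ≤ s)
    {t : ℕ} {f : MvPolynomial (Fin (N + 1)) K} (hf : f ∈ symbolicPower I t) (hf0 : f ≠ 0) :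
    t * s ≤ c * f.totalDegree := by
  -- The exponent is `t * s / c` rounded up: a bound on the degrees of the generating products
  -- becomes membership in a power of the irrelevant ideal, which bounds the degree of every
  -- element.
  have hle : symbolicPower I t ≤ irrelevantIdeal K N ^ ((t * s + (c - 1)) / c) := by
    refine h.symbolicPower_le_of_forall fun a ha => ?_
    refine prod_pow_mem_irrelevantIdeal_pow h.linear a ?_
    have h1 := mul_card_le_mul_sum (by simpa using hcs) ha
    rw [Fintype.card_fin] at h1
    refine Nat.le_of_lt_succ ((Nat.div_lt_iff_lt_mul hc).2 ?_)
    rw [Nat.succ_mul, mul_comm _ c]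
    omega
  have h1 := le_totalDegree_of_mem_irrelevantIdeal_pow (hle hf) hf0
  have h2 := Nat.lt_of_div_lt_div (show (t * s + (c - 1)) / c < (c * (f.totalDegree + 1)) / c by
    rw [Nat.mul_div_cancel_left _ hc]; omega)
  rw [mul_add, mul_one] at h2
  omega

theorem IsStarIdeal.exists_mem_symbolicPower (h : IsStarIdeal ℓ c I) (hc : 1 ≤ c) (hcs : c ≤ s)
    {m : ℕ} (hm : 1 ≤ m) : ∃ f ∈ symbolicPower I m, f ≠ 0 ∧
      c * (f.totalDegree + (c - 1)) ≤ s * (m + (c - 1)) := by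
  obtain ⟨b, hb, hsum⟩ := exists_balanced_exponents (ι := Fin s) hc (by simpa using hcs) hm
  have hne : ∏ i, ℓ i ^ b i ≠ 0 := Finset.prod_ne_zero_iff.2 fun i _ => pow_ne_zero _ (h.ne_zero i)
  refine ⟨∏ i, ℓ i ^ b i, h.mem_symbolicPower_iff.2 fun J hJ =>
    prod_pow_mem_formIdeal_pow J b (hb J hJ), hne, ?_⟩
  have hhom : (∏ i, ℓ i ^ b i).IsHomogeneous (∑ i, b i) :=
    IsHomogeneous.prod _ _ _ fun i _ => by simpa using (h.linear i).pow (b i)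
  rw [hhom.totalDegree hne]
  simpa using hsum

theorem IsStarIdeal.mul_le_mul_alpha (h : IsStarIdeal ℓ c I) (hc : 1 ≤ c) (hcs : c ≤ s)
    {t : ℕ} (ht : 1 ≤ t) : t * s ≤ c * alpha (symbolicPower I t) := by
  obtain ⟨g, hg, hg0, -⟩ := h.exists_mem_symbolicPower hc hcs ht
  obtain ⟨f, hf, hf0, hd⟩ := Nat.sInf_mem
    (s := {d : ℕ | ∃ f ∈ symbolicPower I t, f ≠ 0 ∧ f.totalDegree = d}) ⟨_, g, hg, hg0, rfl⟩
  rw [alpha, ← hd]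
  exact h.mul_le_mul_totalDegree hc hcs hf hf0

theorem IsStarIdeal.mul_alpha_add_le (h : IsStarIdeal ℓ c I) (hc : 1 ≤ c) (hcs : c ≤ s)
    {m : ℕ} (hm : 1 ≤ m) :
    c * (alpha (symbolicPower I m) + (c - 1)) ≤ s * (m + (c - 1)) := by
  obtain ⟨f, hf, hf0, hd⟩ := h.exists_mem_symbolicPower hc hcs hm
  refine le_trans (Nat.mul_le_mul_left c (Nat.add_le_add_right ?_ _)) hd
  exact Nat.sInf_le ⟨f, hf, hf0, rfl⟩

theorem IsStarIdeal.alpha_div_le (h : IsStarIdeal ℓ c I) (hc : 1 ≤ c) (hcs : c ≤ s)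
    {m n t : ℕ} (hm : 1 ≤ m) (hn : c ≤ n) (ht : 1 ≤ t) :
    ((alpha (symbolicPower I m) : ℚ) + n - 1) / ((m : ℚ) + n - 1)
      ≤ (alpha (symbolicPower I t) : ℚ) / t := by
  have h1 := h.mul_le_mul_alpha hc hcs ht
  have h2 := h.mul_alpha_add_le hc hcs hm
  have h1' : (t : ℚ) * s ≤ c * alpha (symbolicPower I t) := by exact_mod_cast h1
  have h2' : (c : ℚ) * (alpha (symbolicPower I m) + (c - 1)) ≤ s * (m + (c - 1)) := by
    have : ((c - 1 : ℕ) : ℚ) = c - 1 := by push_cast [hc]; ring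
    rw [← this]
    exact_mod_cast h2
  have hc' : (1 : ℚ) ≤ c := by exact_mod_cast hc
  have hcs' : (c : ℚ) ≤ s := by exact_mod_cast hcs
  have hn' : (c : ℚ) ≤ n := by exact_mod_cast hn
  have hm' : (1 : ℚ) ≤ m := by exact_mod_cast hm
  have ht' : (1 : ℚ) ≤ t := by exact_mod_cast ht
  generalize (alpha (symbolicPower I m) : ℚ) = x at *
  generalize (alpha (symbolicPower I t) : ℚ) = y at *
  -- Passing from `c` to `n` adds `c * (n - c)` on the left and `s * (n - c)` on the right.
  have h3 : (c : ℚ) * (x + n - 1) ≤ s * (m + n - 1) := by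
    have := mul_le_mul_of_nonneg_right hcs' (sub_nonneg.2 hn')
    linarith
  rw [div_le_div_iff₀ (by linarith) (by linarith)]
  refine le_of_mul_le_mul_left ?_ (show (0 : ℚ) < c by linarith)
  calc (c : ℚ) * ((x + n - 1) * t) = c * (x + n - 1) * t := by ring
    _ ≤ s * (m + n - 1) * t := mul_le_mul_of_nonneg_right h3 (by linarith)
    _ = t * s * (m + n - 1) := by ring
    _ ≤ c * y * (m + n - 1) := mul_le_mul_of_nonneg_right h1' (by linarith)
    _ = c * (y * (m + n - 1)) := by ring

end SymbolicPowers
end StarConfig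

end

/-! ### The main theorem -/

open StarConfig in
theorem proposition4p1 {K : Type*} [Field K] (N s c : ℕ) (hs : N + 1 ≤ s)
    (hc1 : 1 ≤ c) (hcN : c ≤ N)
    (ℓ : Fin s → MvPolynomial (Fin (N + 1)) K) (hℓ : IsProperArrangement ℓ)
    (I M : Ideal (MvPolynomial (Fin (N + 1)) K))
    (hI : I = definingIdeal (starConfiguration ℓ c)) (hM : M = irrelevantIdeal K N)
    (m : ℕ) (hm : 1 ≤ m) :
    -- containments of the first kind
    (symbolicPower I (m * c) ≤ M ^ (m * (c - 1)) * I ^ m ∧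
      (I.height = N → symbolicPower I (m * N) ≤ M ^ (m * (N - 1)) * I ^ m)) ∧
    -- containments of the second kind
    (symbolicPower I (m * c - c + 1) ≤ I ^ m ∧
      symbolicPower I (m * N - N + 1) ≤ I ^ m) ∧
    -- containments of the third kind
    (symbolicPower I (m * c - c + 1) ≤ M ^ ((m - 1) * (c - 1)) * I ^ m ∧
      (I.height = N →
        symbolicPower I (m * N - N + 1) ≤ M ^ ((m - 1) * (N - 1)) * I ^ m)) ∧
    -- lower bounds for the initial degrees
    (∀ t : ℕ, 1 ≤ t →
      ((alpha (symbolicPower I m) : ℚ) + c - 1) / ((m : ℚ) + c - 1)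
        ≤ (alpha (symbolicPower I t) : ℚ) / t) ∧
    (∀ t : ℕ, 1 ≤ t →
      ((alpha (symbolicPower I m) : ℚ) + N - 1) / ((m : ℚ) + N - 1)
        ≤ (alpha (symbolicPower I t) : ℚ) / t) ∧
    (∀ t : ℕ, 1 ≤ t →
      ((alpha I : ℚ) + N - 1) / N ≤ (alpha (symbolicPower I t) : ℚ) / t) := by
  subst hM
  have hstar : IsStarIdeal ℓ c I := hI ▸ hℓ.isStarIdeal hcN
  have hcs : c ≤ s := by omega
  obtain ⟨m, rfl⟩ := Nat.exists_eq_add_of_le' hm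
  have first : ∀ n, c ≤ n → symbolicPower I ((m + 1) * n) ≤
      irrelevantIdeal K N ^ ((m + 1) * (n - 1)) * I ^ (m + 1) := by
    intro n hn
    have h1 := Nat.mul_le_mul_right m hn
    have h2 := hstar.symbolicPower_le hc1 hcs hm (D := (m + 1) * n) (by
      rw [Nat.add_sub_cancel, add_mul, mul_comm m n]; omega)
    rwa [← Nat.mul_sub_one] at h2
  have third : ∀ n, c ≤ n → symbolicPower I ((m + 1) * n - n + 1) ≤
      irrelevantIdeal K N ^ ((m + 1 - 1) * (n - 1)) * I ^ (m + 1) := by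
    intro n hn
    have h1 := Nat.mul_le_mul_right m hn
    have hD : (m + 1) * n - n + 1 = n * m + 1 := by
      rw [add_mul, one_mul, Nat.add_sub_cancel, mul_comm]
    rw [hD]
    have h2 := hstar.symbolicPower_le hc1 hcs hm (D := n * m + 1) (by
      rw [Nat.add_sub_cancel]; omega)
    rwa [Nat.add_sub_add_right, ← Nat.sub_one_mul, mul_comm (n - 1)] at h2
  refine ⟨⟨first c le_rfl, fun _ => first N hcN⟩,
    ⟨(third c le_rfl).trans Ideal.mul_le_right, (third N hcN).trans Ideal.mul_le_right⟩,
    ⟨third c le_rfl, fun _ => third N hcN⟩,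
    fun t ht => hstar.alpha_div_le hc1 hcs hm le_rfl ht,
    fun t ht => hstar.alpha_div_le hc1 hcs hm hcN ht, fun t ht => ?_⟩
  -- The last bound is the case of first symbolic power and `n = N`, where the denominator `1 + N -
  -- 1` is `N`.
  have h1 := hstar.alpha_div_le hc1 hcs le_rfl hcN ht
  rwa [hstar.symbolicPower_one, Nat.cast_one, add_sub_cancel_left] at h1
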